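/- Let $|\phi\rangle\in\mathbb{C}^2\otimes\mathbb{C}^2\otimes\mathbb{C}^2$ be a unit vector (a pure state of three qubits $A,B,C$), let $\rho=|\phi\rangle\langle\phi|$, and let $\rho_{AB}=\mathrm{Tr}_C\,\rho$, $\rho_{AC}=\mathrm{Tr}_B\,\rho$, $\rho_{BC}=\mathrm{Tr}_A\,\rho$ be its two-qubit reduced states. For $ij\in\{AB,AC,BC\}$ let $T_{ij}$ be the real $3\times 3$ matrix with entries $\mathrm{Tr}[\rho_{ij}\,(\sigma_k\otimes\sigma_l)]$, $k,l=1,2,3$, where $\sigma_1,\sigma_2,\sigma_3$ are the Pauli matrices, and put $S_{ij}=\mathrm{Tr}[T_{ij}^{T}T_{ij}]$. Let $\mathcal{C}_{ij}=\max\{0,\lambda_1-\lambda_2-\lambda_3-\lambda_4\}$ be the concurrence of $\rho_{ij}$, where $\lambda_1\ge\lambda_2\ge\lambda_3\ge\lambda_4$ are the square roots of the eigenvalues of $\rho_{ij}(\sigma_2\otimes\sigma_2)\rho_{ij}^{*}(\sigma_2\otimes\sigma_2)$, with $\rho_{ij}^{*}$ the entrywise complex conjugate of $\rho_{ij}$ in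 the computational basis. Define $$S^{\max}_{total}(|\phi\rangle)=\max\{S_{AB}+S_{AC},\;S_{AB}+S_{BC},\;S_{AC}+S_{BC}\},\qquad E_W(|\phi\rangle)=\min\{\mathcal{C}_{AB}^2,\;\mathcal{C}_{AC}^2,\;\mathcal{C}_{BC}^2\}.$$ Then $$S^{\max}_{total}(|\phi\rangle)+3\,E_W(|\phi\rangle)\le\frac{10}{3},$$ and equality holds for the state $|W\rangle=\frac{1}{\sqrt3}(|001\rangle+|010\rangle+|100\rangle)$. -/

import Mathlib

namespace ThreeQubit

open Matrix
open scoped Kronecker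

/-- The three Pauli matrices `σ₁, σ₂, σ₃` (indexed by `0, 1, 2`). -/
noncomputable def pauli : Fin 3 → Matrix (Fin 2) (Fin 2) ℂ :=
  ![!![0, 1; 1, 0], !![0, -Complex.I; Complex.I, 0], !![1, 0; 0, -1]]

/-- The correlation matrix `T = [t_ij]`, `t_ij = Tr[ρ (σ_i ⊗ σ_j)]`, of a two-qubit state `ρ`
(these traces are real for Hermitian `ρ`). -/
noncomputable def correlationMatrix (ρ : Matrix (Fin 2 × Fin 2) (Fin 2 × Fin 2) ℂ) :
    Matrix (Fin 3) (Fin 3) ℝ :=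
  Matrix.of fun i j => (ρ * (pauli i ⊗ₖ pauli j)).trace.re

/-- The steering parameter `S = Tr[Tᵀ T]` of a two-qubit state. -/
noncomputable def steering (ρ : Matrix (Fin 2 × Fin 2) (Fin 2 × Fin 2) ℂ) : ℝ :=
  ((correlationMatrix ρ)ᵀ * correlationMatrix ρ).trace

/-- The spin-flipped state `ρ̃ = (σ₂ ⊗ σ₂) ρ* (σ₂ ⊗ σ₂)`, where `ρ*` is the entrywise complex
conjugate in the computational basis. -/
noncomputable def spinFlip (ρ : Matrix (Fin 2 × Fin 2) (Fin 2 × Fin 2) ℂ) :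
    Matrix (Fin 2 × Fin 2) (Fin 2 × Fin 2) ℂ :=
  (pauli 1 ⊗ₖ pauli 1) * ρ.map star * (pauli 1 ⊗ₖ pauli 1)

/-- The square roots `λ₁ ≥ λ₂ ≥ λ₃ ≥ λ₄` of the eigenvalues of `ρ ρ̃`, with algebraic
multiplicity and in decreasing order (the eigenvalues are real and nonnegative for positive
semidefinite `ρ`). -/
noncomputable def woottersSpectrum (ρ : Matrix (Fin 2 × Fin 2) (Fin 2 × Fin 2) ℂ) : List ℝ :=
  ((ρ * spinFlip ρ).charpoly.roots.map fun z => Real.sqrt z.re).sort (· ≥ ·)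

/-- The concurrence `C(ρ) = max {0, λ₁ - λ₂ - λ₃ - λ₄}` of a two-qubit state. -/
noncomputable def concurrence (ρ : Matrix (Fin 2 × Fin 2) (Fin 2 × Fin 2) ℂ) : ℝ :=
  max 0 ((woottersSpectrum ρ).headD 0 - (woottersSpectrum ρ).tail.sum)

/-- The density matrix `|φ⟩⟨φ|` of a three-qubit vector `φ`. -/
noncomputable def pureDensity (φ : EuclideanSpace ℂ (Fin 2 × Fin 2 × Fin 2)) :
    Matrix (Fin 2 × Fin 2 × Fin 2) (Fin 2 × Fin 2 × Fin 2) ℂ :=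
  Matrix.of fun p q => φ p * star (φ q)

/-- The reduced state `ρ_AB = Tr_C ρ`. -/
noncomputable def reducedAB (ρ : Matrix (Fin 2 × Fin 2 × Fin 2) (Fin 2 × Fin 2 × Fin 2) ℂ) :
    Matrix (Fin 2 × Fin 2) (Fin 2 × Fin 2) ℂ :=
  Matrix.of fun p q => ∑ c : Fin 2, ρ (p.1, p.2, c) (q.1, q.2, c)

/-- The reduced state `ρ_AC = Tr_B ρ`. -/
noncomputable def reducedAC (ρ : Matrix (Fin 2 × Fin 2 × Fin 2) (Fin 2 × Fin 2 × Fin 2) ℂ) :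
    Matrix (Fin 2 × Fin 2) (Fin 2 × Fin 2) ℂ :=
  Matrix.of fun p q => ∑ b : Fin 2, ρ (p.1, b, p.2) (q.1, b, q.2)

/-- The reduced state `ρ_BC = Tr_A ρ`. -/
noncomputable def reducedBC (ρ : Matrix (Fin 2 × Fin 2 × Fin 2) (Fin 2 × Fin 2 × Fin 2) ℂ) :
    Matrix (Fin 2 × Fin 2) (Fin 2 × Fin 2) ℂ :=
  Matrix.of fun p q => ∑ a : Fin 2, ρ (a, p.1, p.2) (a, q.1, q.2)

/-- `S^max_total(ρ) = max {S_AB + S_AC, S_AB + S_BC, S_AC + S_BC}`. -/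
noncomputable def steeringMaxTotal
    (ρ : Matrix (Fin 2 × Fin 2 × Fin 2) (Fin 2 × Fin 2 × Fin 2) ℂ) : ℝ :=
  max (steering (reducedAB ρ) + steering (reducedAC ρ))
    (max (steering (reducedAB ρ) + steering (reducedBC ρ))
      (steering (reducedAC ρ) + steering (reducedBC ρ)))

/-- The W entanglement `E_W = min {C_AB², C_AC², C_BC²}`. -/
noncomputable def wEntanglement
    (ρ : Matrix (Fin 2 × Fin 2 × Fin 2) (Fin 2 × Fin 2 × Fin 2) ℂ) : ℝ :=
  min (concurrence (reducedAB ρ) ^ 2)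
    (min (concurrence (reducedAC ρ) ^ 2) (concurrence (reducedBC ρ) ^ 2))

/-- The W state `(|001⟩ + |010⟩ + |100⟩) / √3`. -/
noncomputable def wState : EuclideanSpace ℂ (Fin 2 × Fin 2 × Fin 2) :=
  ((1 / Real.sqrt 3 : ℝ) : ℂ) •
    (EuclideanSpace.single (0, 0, 1) 1 + EuclideanSpace.single (0, 1, 0) 1 +
      EuclideanSpace.single (1, 0, 0) 1)

end ThreeQubit

namespace ThreeQubit

open Matrix
open scoped Kronecker

/-! Write `P` for `flipNorm` of a pair and `h` for `‖hyperdet‖`, which is the same for all pairs.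
For a unit vector `S_AB = 1 + 2 P_AB - P_AC - P_BC` (`steering_pairState`), and `C² = P - 2h`
(`concurrence_pairState_sq`). In a sum of two `S` the `h` terms cancel: `S_AB + S_AC = 2 + C_AB² +
C_AC² - 2 C_BC²`. The maximum therefore omits the least `C²`, and adding `3 E_W` gives exactly `2 +
C_AB² + C_AC² + C_BC²`.

It remains to bound the sum of the squared concurrences by `4/3` (`totalTangle_le`). This sum is
invariant under local unitaries, which reduce the vector to five terms (`exists_canonical_form`),
where the bound is elementary. -/

/-- The density matrix of the first two qubits of the three-qubit vector with coefficients `f`. -/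
noncomputable def pairState (f : Fin 2 → Fin 2 → Fin 2 → ℂ) :
    Matrix (Fin 2 × Fin 2) (Fin 2 × Fin 2) ℂ :=
  Matrix.of fun p q => ∑ c : Fin 2, f p.1 p.2 c * star (f q.1 q.2 c)

/-- The symmetric bilinear form `vᵀ (σ₂ ⊗ σ₂) w` evaluated on the slices of `f` in the third
index. -/
def flipForm (f : Fin 2 → Fin 2 → Fin 2 → ℂ) (c d : Fin 2) : ℂ :=
  f 0 1 c * f 1 0 d + f 1 0 c * f 0 1 d - f 0 0 c * f 1 1 d - f 1 1 c * f 0 0 d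

/-- The squared Frobenius norm of `flipForm f`. -/
noncomputable def flipNorm (f : Fin 2 → Fin 2 → Fin 2 → ℂ) : ℝ :=
  ‖flipForm f 0 0‖ ^ 2 + 2 * ‖flipForm f 0 1‖ ^ 2 + ‖flipForm f 1 1‖ ^ 2

/-- Cayley's hyperdeterminant, as the determinant of `flipForm f`. -/
def hyperdet (f : Fin 2 → Fin 2 → Fin 2 → ℂ) : ℂ :=
  flipForm f 0 0 * flipForm f 1 1 - flipForm f 0 1 ^ 2

/-- The squared Euclidean norm of the coefficients. -/
noncomputable def totalNormSq (f : Fin 2 → Fin 2 → Fin 2 → ℂ) : ℝ :=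
  ∑ a, ∑ b, ∑ c, ‖f a b c‖ ^ 2

/-- Exchange of the last two qubits. -/
def swapLast (f : Fin 2 → Fin 2 → Fin 2 → ℂ) : Fin 2 → Fin 2 → Fin 2 → ℂ :=
  fun a c b => f a b c

/-- Cyclic shift of the qubits, moving the first one to the end. -/
def cycle (f : Fin 2 → Fin 2 → Fin 2 → ℂ) : Fin 2 → Fin 2 → Fin 2 → ℂ :=
  fun b c a => f a b c

/-! ### Steering and concurrence through the flip form -/

theorem steering_pairState (f : Fin 2 → Fin 2 → Fin 2 → ℂ) :
    steering (pairState f) =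
      totalNormSq f ^ 2 + 2 * flipNorm f - flipNorm (swapLast f) - flipNorm (cycle f) := by
  simp only [steering, correlationMatrix, Matrix.trace, Matrix.diag, Matrix.mul_apply,
    Matrix.transpose_apply, Matrix.of_apply, Fin.sum_univ_three, Fintype.sum_prod_type,
    Fin.sum_univ_two, kroneckerMap_apply, pairState, pauli, totalNormSq, flipNorm, flipForm,
    swapLast, cycle, Complex.sq_norm, Complex.normSq_apply]
  simp
  ring

theorem two_mul_norm_hyperdet_le (f : Fin 2 → Fin 2 → Fin 2 → ℂ) :
    2 * ‖hyperdet f‖ ≤ flipNorm f := by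
  have h : ‖hyperdet f‖ ≤ ‖flipForm f 0 0‖ * ‖flipForm f 1 1‖ + ‖flipForm f 0 1‖ ^ 2 := by
    rw [← norm_mul, ← norm_pow]
    exact norm_sub_le _ _
  unfold flipNorm
  nlinarith [sq_nonneg (‖flipForm f 0 0‖ - ‖flipForm f 1 1‖)]

/-- With `V` the 4×2 matrix of coefficients, `ρ = V Vᴴ`. Moving `V` cyclically turns `ρ ρ̃` into the
2×2 product `M* M`, `M = Vᵀ J V` the symmetric flip form, at the cost of a factor `X ^ 2`. -/
theorem charpoly_pairState_mul_spinFlip (f : Fin 2 → Fin 2 → Fin 2 → ℂ) :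
    (pairState f * spinFlip (pairState f)).charpoly =
      Polynomial.X ^ 2 * (Polynomial.X ^ 2 - Polynomial.C (flipNorm f : ℂ) * Polynomial.X +
        Polynomial.C ((‖hyperdet f‖ : ℂ) ^ 2)) := by
  let V : Matrix (Fin 2 × Fin 2) (Fin 2) ℂ := Matrix.of fun p c => f p.1 p.2 c
  let J := pauli 1 ⊗ₖ pauli 1
  have hV : pairState f = V * Vᴴ := by
    ext p q
    simp [pairState, V, Matrix.mul_apply]
  have hW : spinFlip (pairState f) = J * (V.map star * Vᵀ) * J := by
    rw [spinFlip]
    congr 2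
    ext p q
    simp [pairState, V, Matrix.mul_apply]
  have hM : Vᵀ * J * V = Matrix.of (flipForm f) := by
    ext c d
    simp [V, J, pauli, Matrix.mul_apply, Fintype.sum_prod_type, flipForm]
    ring
  have hM' : Vᴴ * J * V.map star = (Matrix.of (flipForm f)).map star := by
    rw [← hM]
    ext c d
    simp [V, J, pauli, Matrix.mul_apply, Fintype.sum_prod_type]
  have hprod : pairState f * spinFlip (pairState f) =
      V * (Vᴴ * J * V.map star * (Vᵀ * J)) := by
    rw [hW, hV]
    simp only [Matrix.mul_assoc]
  have hsymm : flipForm f 1 0 = flipForm f 0 1 := by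
    simp only [flipForm]
    ring
  rw [hprod, Matrix.charpoly_mul_comm_of_le _ _ (by simp), Matrix.mul_assoc, hM, hM',
    Matrix.charpoly_fin_two]
  congr 4
  · simp only [Matrix.trace_fin_two, Matrix.mul_apply, Fin.sum_univ_two, Matrix.map_apply,
      Matrix.of_apply, hsymm, flipNorm, Complex.ofReal_add, Complex.ofReal_mul, Complex.ofReal_pow,
      ← Complex.conj_mul', Complex.star_def, Complex.ofReal_ofNat]
    ring_nf
  · rw [← Complex.conj_mul', Matrix.det_mul]
    simp only [Matrix.det_fin_two, Matrix.map_apply, Matrix.of_apply, hsymm, hyperdet,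
      Complex.star_def, map_sub, map_mul, map_pow]
    ring

theorem concurrence_pairState_sq (f : Fin 2 → Fin 2 → Fin 2 → ℂ) :
    concurrence (pairState f) ^ 2 = flipNorm f - 2 * ‖hyperdet f‖ := by
  have hle := two_mul_norm_hyperdet_le f
  have hh := norm_nonneg (hyperdet f)
  set P := flipNorm f with hP
  set h := ‖hyperdet f‖ with hhdef
  -- `s` and `d` are the sum and difference of the singular values of the flip form, whose squares
  -- sum to `P` and whose product is `h`.
  set s := √(P + 2 * h) with hs
  set d := √(P - 2 * h) with hd
  have hs2 : s ^ 2 = P + 2 * h := Real.sq_sqrt (by linarith)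
  have hd2 : d ^ 2 = P - 2 * h := Real.sq_sqrt (by linarith)
  have hd0 : 0 ≤ d := Real.sqrt_nonneg _
  have hds : d ≤ s := Real.sqrt_le_sqrt (by linarith)
  have hroots : (pairState f * spinFlip (pairState f)).charpoly.roots =
      {((((s + d) / 2) ^ 2 : ℝ) : ℂ), ((((s - d) / 2) ^ 2 : ℝ) : ℂ), 0, 0} := by
    rw [← Polynomial.roots_multiset_prod_X_sub_C
      ({((((s + d) / 2) ^ 2 : ℝ) : ℂ), ((((s - d) / 2) ^ 2 : ℝ) : ℂ), 0, 0} : Multiset ℂ),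
      charpoly_pairState_mul_spinFlip]
    congr 1
    have e1 : (flipNorm f : ℂ) =
        ((((s + d) / 2) ^ 2 : ℝ) : ℂ) + ((((s - d) / 2) ^ 2 : ℝ) : ℂ) := by
      rw [← Complex.ofReal_add, ← hP]
      congr 1
      linarith
    have e2 : (‖hyperdet f‖ : ℂ) ^ 2 =
        ((((s + d) / 2) ^ 2 : ℝ) : ℂ) * ((((s - d) / 2) ^ 2 : ℝ) : ℂ) := by
      rw [← Complex.ofReal_mul, ← Complex.ofReal_pow, ← hhdef]
      congr 1
      have : (s + d) / 2 * ((s - d) / 2) = h := by linarith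
      rw [← mul_pow, this]
    rw [e1, e2]
    simp only [Multiset.insert_eq_cons, Multiset.map_cons, Multiset.map_singleton,
      Multiset.prod_cons, Multiset.prod_singleton, map_add, map_mul, map_zero]
    ring
  have hspec : woottersSpectrum (pairState f) = [(s + d) / 2, (s - d) / 2, 0, 0] := by
    rw [woottersSpectrum, hroots]
    have hm : (Multiset.map (fun z : ℂ => √z.re)
        {((((s + d) / 2) ^ 2 : ℝ) : ℂ), ((((s - d) / 2) ^ 2 : ℝ) : ℂ), 0, 0}) =
        (([(s + d) / 2, (s - d) / 2, 0, 0] : List ℝ) : Multiset ℝ) := by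
      simp only [Multiset.insert_eq_cons, Multiset.map_cons, Multiset.map_singleton,
        Complex.ofReal_re, Complex.zero_re, Real.sqrt_zero]
      rw [Real.sqrt_sq (by linarith), Real.sqrt_sq (by linarith)]
      rfl
    rw [hm, Multiset.coe_sort]
    apply List.mergeSort_of_pairwise
    simp
    exact ⟨⟨by linarith, by linarith⟩, by linarith⟩
  rw [concurrence, hspec]
  simp only [List.headD_cons, List.tail_cons, List.sum_cons, List.sum_nil, add_zero]
  rw [show (s + d) / 2 - (s - d) / 2 = d by ring, max_eq_right hd0, hd2]

/-! ### Permutations of the qubits -/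

/-- The squared concurrence of the first two qubits. -/
noncomputable def tangle (f : Fin 2 → Fin 2 → Fin 2 → ℂ) : ℝ :=
  flipNorm f - 2 * ‖hyperdet f‖

/-- The sum of the three squared pairwise concurrences. -/
noncomputable def totalTangle (f : Fin 2 → Fin 2 → Fin 2 → ℂ) : ℝ :=
  tangle f + tangle (swapLast f) + tangle (cycle f)

theorem hyperdet_swapLast (f : Fin 2 → Fin 2 → Fin 2 → ℂ) :
    hyperdet (swapLast f) = hyperdet f := by
  simp only [hyperdet, flipForm, swapLast]
  ring

theorem hyperdet_cycle (f : Fin 2 → Fin 2 → Fin 2 → ℂ) :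
    hyperdet (cycle f) = hyperdet f := by
  simp only [hyperdet, flipForm, cycle]
  ring

/-- Makes `flipNorm` depend only on the unordered pair of qubits. -/
theorem flipForm_swapFirst (f : Fin 2 → Fin 2 → Fin 2 → ℂ) :
    flipForm (fun a b c => f b a c) = flipForm f := by
  funext c d
  simp only [flipForm]
  ring

theorem flipNorm_cycle_swapLast (f : Fin 2 → Fin 2 → Fin 2 → ℂ) :
    flipNorm (cycle (swapLast f)) = flipNorm (cycle f) := by
  have h := flipForm_swapFirst (cycle f)
  rw [flipNorm, flipNorm, ← h]
  rfl

theorem flipNorm_cycle_cycle (f : Fin 2 → Fin 2 → Fin 2 → ℂ) :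
    flipNorm (cycle (cycle f)) = flipNorm (swapLast f) := by
  have h := flipForm_swapFirst (swapLast f)
  rw [flipNorm, flipNorm, ← h]
  rfl

theorem flipNorm_swapLast_cycle (f : Fin 2 → Fin 2 → Fin 2 → ℂ) :
    flipNorm (swapLast (cycle f)) = flipNorm f := by
  have h := flipForm_swapFirst f
  rw [flipNorm, flipNorm, ← h]
  rfl

theorem totalNormSq_swapLast (f : Fin 2 → Fin 2 → Fin 2 → ℂ) :
    totalNormSq (swapLast f) = totalNormSq f := by
  simp only [totalNormSq, swapLast, Fin.sum_univ_two]
  ring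

theorem totalNormSq_cycle (f : Fin 2 → Fin 2 → Fin 2 → ℂ) :
    totalNormSq (cycle f) = totalNormSq f := by
  simp only [totalNormSq, cycle, Fin.sum_univ_two]
  ring

theorem totalTangle_swapLast (f : Fin 2 → Fin 2 → Fin 2 → ℂ) :
    totalTangle (swapLast f) = totalTangle f := by
  simp only [totalTangle, tangle, flipNorm_cycle_swapLast, hyperdet_swapLast, hyperdet_cycle]
  rw [show swapLast (swapLast f) = f from rfl]
  ring

theorem totalTangle_cycle (f : Fin 2 → Fin 2 → Fin 2 → ℂ) :
    totalTangle (cycle f) = totalTangle f := by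
  simp only [totalTangle, tangle, flipNorm_cycle_cycle, flipNorm_swapLast_cycle,
    hyperdet_swapLast, hyperdet_cycle]
  ring

/-! ### Invariance under local unitaries -/

/-- The action of the matrix `[[α, β], [-β*, α*]]` on the last qubit. -/
noncomputable def rotateLast (α β : ℂ) (f : Fin 2 → Fin 2 → Fin 2 → ℂ) :
    Fin 2 → Fin 2 → Fin 2 → ℂ :=
  fun a b => ![α * f a b 0 + β * f a b 1, -star β * f a b 0 + star α * f a b 1]

theorem norm_sq_rotate {α β : ℂ} (h : ‖α‖ ^ 2 + ‖β‖ ^ 2 = 1) (x y : ℂ) :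
    ‖α * x + β * y‖ ^ 2 + ‖-star β * x + star α * y‖ ^ 2 = ‖x‖ ^ 2 + ‖y‖ ^ 2 := by
  apply Complex.ofReal_injective
  replace h := congrArg Complex.ofReal h
  push_cast [← Complex.conj_mul'] at h ⊢
  simp only [Complex.star_def, map_add, map_mul, map_neg, Complex.conj_conj]
  linear_combination (x * (starRingEnd ℂ) x + y * (starRingEnd ℂ) y) * h

theorem totalNormSq_rotateLast {α β : ℂ} (h : ‖α‖ ^ 2 + ‖β‖ ^ 2 = 1)
    (f : Fin 2 → Fin 2 → Fin 2 → ℂ) : totalNormSq (rotateLast α β f) = totalNormSq f := by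
  refine Finset.sum_congr rfl fun a _ => Finset.sum_congr rfl fun b _ => ?_
  rw [Fin.sum_univ_two, Fin.sum_univ_two]
  exact norm_sq_rotate h _ _

/-- The flip form `M` becomes `U M Uᵀ` with `U` unitary, which keeps the Frobenius norm. -/
theorem flipNorm_rotateLast {α β : ℂ} (h : ‖α‖ ^ 2 + ‖β‖ ^ 2 = 1)
    (f : Fin 2 → Fin 2 → Fin 2 → ℂ) : flipNorm (rotateLast α β f) = flipNorm f := by
  have h00 : flipForm (rotateLast α β f) 0 0 =
      α ^ 2 * flipForm f 0 0 + 2 * α * β * flipForm f 0 1 + β ^ 2 * flipForm f 1 1 := by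
    simp [flipForm, rotateLast]
    ring
  have h01 : flipForm (rotateLast α β f) 0 1 =
      -α * star β * flipForm f 0 0 + (α * star α - β * star β) * flipForm f 0 1
        + β * star α * flipForm f 1 1 := by
    simp [flipForm, rotateLast]
    ring
  have h11 : flipForm (rotateLast α β f) 1 1 =
      star β ^ 2 * flipForm f 0 0 - 2 * star α * star β * flipForm f 0 1
        + star α ^ 2 * flipForm f 1 1 := by
    simp [flipForm, rotateLast]
    ring
  rw [flipNorm, flipNorm, h00, h01, h11]
  generalize flipForm f 0 0 = x
  generalize flipForm f 0 1 = y
  generalize flipForm f 1 1 = z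
  apply Complex.ofReal_injective
  replace h := congrArg Complex.ofReal h
  push_cast [← Complex.conj_mul'] at h ⊢
  simp only [Complex.star_def, map_add, map_sub, map_mul, map_neg, map_pow, Complex.conj_conj,
    map_ofNat]
  linear_combination (x * (starRingEnd ℂ) x + 2 * y * (starRingEnd ℂ) y + z * (starRingEnd ℂ) z) *
    ((starRingEnd ℂ) α * α + (starRingEnd ℂ) β * β + 1) * h

theorem det_rotate {α β : ℂ} (h : ‖α‖ ^ 2 + ‖β‖ ^ 2 = 1) : α * star α + β * star β = 1 := by
  replace h := congrArg Complex.ofReal h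
  push_cast [← Complex.mul_conj'] at h
  exact h

/-- Here the rotated qubit is one of the contracted pair, and the form is alternating in it, so it
only picks up the determinant `1`. -/
theorem flipForm_swapLast_rotateLast {α β : ℂ} (h : ‖α‖ ^ 2 + ‖β‖ ^ 2 = 1)
    (f : Fin 2 → Fin 2 → Fin 2 → ℂ) :
    flipForm (swapLast (rotateLast α β f)) = flipForm (swapLast f) := by
  funext c d
  simp only [flipForm, swapLast, rotateLast, Matrix.cons_val_zero, Matrix.cons_val_one]
  linear_combination (f 0 c 1 * f 1 d 0 + f 1 c 0 * f 0 d 1 - f 0 c 0 * f 1 d 1 -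
    f 1 c 1 * f 0 d 0) * det_rotate h

theorem flipForm_cycle_rotateLast {α β : ℂ} (h : ‖α‖ ^ 2 + ‖β‖ ^ 2 = 1)
    (f : Fin 2 → Fin 2 → Fin 2 → ℂ) :
    flipForm (cycle (rotateLast α β f)) = flipForm (cycle f) := by
  funext c d
  simp only [flipForm, cycle, rotateLast, Matrix.cons_val_zero, Matrix.cons_val_one]
  linear_combination (f c 0 1 * f d 1 0 + f c 1 0 * f d 0 1 - f c 0 0 * f d 1 1 -
    f c 1 1 * f d 0 0) * det_rotate h

theorem hyperdet_rotateLast {α β : ℂ} (h : ‖α‖ ^ 2 + ‖β‖ ^ 2 = 1)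
    (f : Fin 2 → Fin 2 → Fin 2 → ℂ) : hyperdet (rotateLast α β f) = hyperdet f := by
  rw [← hyperdet_cycle, ← hyperdet_cycle f, hyperdet, hyperdet, flipForm_cycle_rotateLast h]

theorem totalTangle_rotateLast {α β : ℂ} (h : ‖α‖ ^ 2 + ‖β‖ ^ 2 = 1)
    (f : Fin 2 → Fin 2 → Fin 2 → ℂ) : totalTangle (rotateLast α β f) = totalTangle f := by
  simp only [totalTangle, tangle, flipNorm_rotateLast h, hyperdet_rotateLast h, hyperdet_swapLast,
    hyperdet_cycle]
  simp only [flipNorm, flipForm_swapLast_rotateLast h, flipForm_cycle_rotateLast h]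

/-! ### Canonical form -/

theorem exists_smul_unit (x y : ℂ) (hxy : x ≠ 0 ∨ y ≠ 0) :
    ∃ r : ℂ, ‖r * x‖ ^ 2 + ‖r * y‖ ^ 2 = 1 := by
  have hpos : 0 < ‖x‖ ^ 2 + ‖y‖ ^ 2 := by
    rcases hxy with h | h <;> have := norm_pos_iff.mpr h <;> positivity
  refine ⟨((√(‖x‖ ^ 2 + ‖y‖ ^ 2))⁻¹ : ℝ), ?_⟩
  rw [norm_mul, norm_mul, mul_pow, mul_pow, ← mul_add, Complex.norm_real, Real.norm_eq_abs, sq_abs,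
    inv_pow, Real.sq_sqrt hpos.le, inv_mul_cancel₀ hpos.ne']

/-- A binary quadratic form over `ℂ` has an isotropic unit vector. -/
theorem exists_unit_isotropic (a b c : ℂ) :
    ∃ α β : ℂ, ‖α‖ ^ 2 + ‖β‖ ^ 2 = 1 ∧ α ^ 2 * a + 2 * α * β * b + β ^ 2 * c = 0 := by
  by_cases hc : c = 0
  · exact ⟨0, 1, by simp, by simp [hc]⟩
  · obtain ⟨z, hz⟩ := IsAlgClosed.exists_eq_mul_self (b ^ 2 - a * c)
    -- Quadratic formula: `β / α = (z - b) / c`.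
    obtain ⟨r, hr⟩ := exists_smul_unit c (z - b) (Or.inl hc)
    refine ⟨r * c, r * (z - b), hr, ?_⟩
    linear_combination -(r ^ 2 * c) * hz

theorem exists_unit_mul_add_eq_zero (x y : ℂ) :
    ∃ α β : ℂ, ‖α‖ ^ 2 + ‖β‖ ^ 2 = 1 ∧ -star β * x + star α * y = 0 := by
  by_cases h : x ≠ 0 ∨ y ≠ 0
  · obtain ⟨r, hr⟩ := exists_smul_unit (star x) (star y) (by simpa using h)
    refine ⟨r * star x, r * star y, hr, ?_⟩
    simp only [star_mul', star_star]
    ring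
  · push Not at h
    exact ⟨1, 0, by simp, by simp [h]⟩

/-- The columns of a singular matrix are proportional, so a rotation that clears the lower entry of
a nonzero column clears that of the other. -/
theorem exists_unit_row_eq_zero (v : Fin 2 → Fin 2 → ℂ) (hv : v 0 0 * v 1 1 = v 0 1 * v 1 0) :
    ∃ α β : ℂ, ‖α‖ ^ 2 + ‖β‖ ^ 2 = 1 ∧ ∀ j, -star β * v 0 j + star α * v 1 j = 0 := by
  by_cases h : v 0 0 = 0 ∧ v 1 0 = 0
  · obtain ⟨α, β, hu, h1⟩ := exists_unit_mul_add_eq_zero (v 0 1) (v 1 1)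
    refine ⟨α, β, hu, Fin.forall_fin_two.mpr ⟨by simp [h], h1⟩⟩
  · obtain ⟨α, β, hu, h0⟩ := exists_unit_mul_add_eq_zero (v 0 0) (v 1 0)
    refine ⟨α, β, hu, Fin.forall_fin_two.mpr ⟨h0, ?_⟩⟩
    rw [not_and_or] at h
    rcases h with h | h <;> apply mul_left_cancel₀ h
    · linear_combination v 0 1 * h0 + star α * hv
    · linear_combination v 1 1 * h0 + star β * hv

/-- Local unitaries bring a three-qubit vector to the form
`s|000⟩ + p|001⟩ + q|011⟩ + r|101⟩ + t|111⟩`. -/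
theorem exists_canonical_form (f : Fin 2 → Fin 2 → Fin 2 → ℂ) :
    ∃ g : Fin 2 → Fin 2 → Fin 2 → ℂ, totalNormSq g = totalNormSq f ∧
      totalTangle g = totalTangle f ∧ g 0 1 0 = 0 ∧ g 1 0 0 = 0 ∧ g 1 1 0 = 0 := by
  -- The `0 0` entry of the flip form is `-2` times the determinant of the slice with third qubit
  -- `0`, so an isotropic vector makes that slice singular.
  obtain ⟨α, β, hu, hiso⟩ :=
    exists_unit_isotropic (flipForm f 0 0) (flipForm f 0 1) (flipForm f 1 1)
  have hdet : rotateLast α β f 0 0 0 * rotateLast α β f 1 1 0 =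
      rotateLast α β f 0 1 0 * rotateLast α β f 1 0 0 := by
    simp only [flipForm] at hiso
    simp only [rotateLast, Matrix.cons_val_zero]
    linear_combination -hiso / 2
  have hN := totalNormSq_rotateLast hu f
  have hT := totalTangle_rotateLast hu f
  generalize rotateLast α β f = f₁ at hdet hN hT
  obtain ⟨α, β, hu, hrow⟩ := exists_unit_row_eq_zero (fun a b => f₁ a b 0) hdet
  -- Rotation of the first qubit: cycle it to the end, rotate, cycle back.
  let f₂ : Fin 2 → Fin 2 → Fin 2 → ℂ := fun a b c => rotateLast α β (cycle f₁) b c a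
  have hN₂ : totalNormSq f₂ = totalNormSq f := by
    rw [← totalNormSq_cycle f₂, show cycle f₂ = rotateLast α β (cycle f₁) from rfl,
      totalNormSq_rotateLast hu, totalNormSq_cycle, hN]
  have hT₂ : totalTangle f₂ = totalTangle f := by
    rw [← totalTangle_cycle f₂, show cycle f₂ = rotateLast α β (cycle f₁) from rfl,
      totalTangle_rotateLast hu, totalTangle_cycle, hT]
  have hf₂ : ∀ b, f₂ 1 b 0 = 0 := hrow
  obtain ⟨α, β, hu, hz⟩ := exists_unit_mul_add_eq_zero (f₂ 0 0 0) (f₂ 0 1 0)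
  refine ⟨swapLast (rotateLast α β (swapLast f₂)), ?_, ?_, hz, ?_, ?_⟩
  · rw [totalNormSq_swapLast, totalNormSq_rotateLast hu, totalNormSq_swapLast, hN₂]
  · rw [totalTangle_swapLast, totalTangle_rotateLast hu, totalTangle_swapLast, hT₂]
  · simp [swapLast, rotateLast, hf₂]
  · simp [swapLast, rotateLast, hf₂]

/-! ### The sharp bound -/

theorem totalTangle_le (f : Fin 2 → Fin 2 → Fin 2 → ℂ) :
    totalTangle f ≤ 4 / 3 * totalNormSq f ^ 2 := by
  obtain ⟨g, hN, hT, h1, h2, h3⟩ := exists_canonical_form f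
  rw [← hN, ← hT]
  have e : totalTangle g = 4 * ‖g 0 1 1 * g 1 0 1 - g 0 0 1 * g 1 1 1‖ ^ 2 +
      4 * ‖g 0 0 0‖ ^ 2 * (‖g 1 0 1‖ ^ 2 + ‖g 0 1 1‖ ^ 2) := by
    simp only [totalTangle, tangle, hyperdet_swapLast, hyperdet_cycle]
    have hm : flipForm g 1 1 = 2 * (g 0 1 1 * g 1 0 1 - g 0 0 1 * g 1 1 1) := by
      simp only [flipForm]
      ring
    rw [flipNorm, hyperdet, hm]
    simp only [flipNorm, flipForm, swapLast, cycle, h1, h2, h3]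
    simp only [mul_zero, zero_mul, add_zero, zero_sub, sub_zero, norm_neg, norm_mul,
      norm_pow, norm_zero, Complex.norm_ofNat]
    simp only [← neg_add', norm_neg, ← two_mul,
      mul_comm (g 1 0 1) (g 0 0 0), mul_comm (g 0 1 1) (g 0 0 0), norm_mul, Complex.norm_ofNat]
    ring
  have hsub : ‖g 0 1 1 * g 1 0 1 - g 0 0 1 * g 1 1 1‖ ≤
      ‖g 0 1 1‖ * ‖g 1 0 1‖ + ‖g 0 0 1‖ * ‖g 1 1 1‖ := by
    rw [← norm_mul, ← norm_mul]
    exact norm_sub_le _ _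
  have hsum : totalNormSq g = ‖g 0 0 0‖ ^ 2 +
      (‖g 0 0 1‖ ^ 2 + ‖g 0 1 1‖ ^ 2 + ‖g 1 0 1‖ ^ 2 + ‖g 1 1 1‖ ^ 2) := by
    simp only [totalNormSq, Fin.sum_univ_two, h1, h2, h3, norm_zero]
    ring
  rw [e, hsum]
  set T := ‖g 0 0 1‖ ^ 2 + ‖g 0 1 1‖ ^ 2 + ‖g 1 0 1‖ ^ 2 + ‖g 1 1 1‖ ^ 2 with hTdef
  have hhalf : 2 * ‖g 0 1 1 * g 1 0 1 - g 0 0 1 * g 1 1 1‖ ≤ T := by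
    nlinarith [sq_nonneg (‖g 0 1 1‖ - ‖g 1 0 1‖), sq_nonneg (‖g 0 0 1‖ - ‖g 1 1 1‖)]
  have hsq := pow_le_pow_left₀ (by positivity) hhalf 2
  have hk : ‖g 1 0 1‖ ^ 2 + ‖g 0 1 1‖ ^ 2 ≤ T := by
    nlinarith [sq_nonneg ‖g 0 0 1‖, sq_nonneg ‖g 1 1 1‖]
  have := mul_le_mul_of_nonneg_left hk (by positivity : 0 ≤ 4 * ‖g 0 0 0‖ ^ 2)
  -- With `x = ‖g 0 0 0‖ ^ 2` the sum is at most `T² + 4xT = 4/3 (x + T)² - (2x - T)² / 3`.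
  nlinarith [sq_nonneg (2 * ‖g 0 0 0‖ ^ 2 - T)]

/-- The coefficients of a three-qubit vector. -/
def coeff (φ : EuclideanSpace ℂ (Fin 2 × Fin 2 × Fin 2)) : Fin 2 → Fin 2 → Fin 2 → ℂ :=
  fun a b c => φ (a, b, c)

theorem totalNormSq_coeff (φ : EuclideanSpace ℂ (Fin 2 × Fin 2 × Fin 2)) :
    totalNormSq (coeff φ) = ‖φ‖ ^ 2 := by
  rw [EuclideanSpace.norm_sq_eq]
  simp only [Fintype.sum_prod_type, totalNormSq, coeff]

/-- Each entry of the maximum is `2 + x + y + z` minus three times one variable; the largest drops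
the minimum. -/
theorem max_add_add_three_mul_min (x y z : ℝ) :
    max (2 + x + y - 2 * z) (max (2 + x + z - 2 * y) (2 + y + z - 2 * x)) +
      3 * min x (min y z) = 2 + x + y + z := by
  rcases le_total x y with h1 | h1 <;> rcases le_total y z with h2 | h2 <;>
    rcases le_total x z with h3 | h3 <;>
    grind

theorem steeringMaxTotal_add (φ : EuclideanSpace ℂ (Fin 2 × Fin 2 × Fin 2)) (hφ : ‖φ‖ = 1) :
    steeringMaxTotal (pureDensity φ) + 3 * wEntanglement (pureDensity φ) =
      2 + totalTangle (coeff φ) := by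
  have hAB : reducedAB (pureDensity φ) = pairState (coeff φ) := rfl
  have hAC : reducedAC (pureDensity φ) = pairState (swapLast (coeff φ)) := rfl
  have hBC : reducedBC (pureDensity φ) = pairState (cycle (coeff φ)) := rfl
  have hN : totalNormSq (coeff φ) = 1 := by rw [totalNormSq_coeff, hφ, one_pow]
  rw [steeringMaxTotal, wEntanglement, hAB, hAC, hBC]
  simp only [concurrence_pairState_sq, steering_pairState, totalNormSq_swapLast, totalNormSq_cycle,
    hN, flipNorm_cycle_swapLast, flipNorm_cycle_cycle, flipNorm_swapLast_cycle]
  rw [show swapLast (swapLast (coeff φ)) = coeff φ from rfl]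
  have := max_add_add_three_mul_min (tangle (coeff φ)) (tangle (swapLast (coeff φ)))
    (tangle (cycle (coeff φ)))
  rw [totalTangle, ← add_assoc, ← add_assoc, ← this]
  simp only [tangle, hyperdet_swapLast, hyperdet_cycle]
  ring_nf

theorem norm_wState : ‖wState‖ = 1 := by
  have h : ‖wState‖ ^ 2 = 1 := by
    rw [← totalNormSq_coeff]
    simp [totalNormSq, coeff, wState]
    norm_num
  exact (pow_eq_one_iff_of_nonneg (norm_nonneg _) two_ne_zero).mp h

theorem totalTangle_wState : totalTangle (coeff wState) = 4 / 3 := by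
  have h3 : (√3) ^ 2 = (3 : ℝ) := Real.sq_sqrt (by norm_num)
  simp [totalTangle, tangle, hyperdet, flipNorm, flipForm, swapLast, cycle, coeff, wState]
  ring_nf
  simp [h3]
  norm_num

end ThreeQubit

theorem theorem6 :
    (∀ φ : EuclideanSpace ℂ (Fin 2 × Fin 2 × Fin 2), ‖φ‖ = 1 →
      ThreeQubit.steeringMaxTotal (ThreeQubit.pureDensity φ) +
        3 * ThreeQubit.wEntanglement (ThreeQubit.pureDensity φ) ≤ 10 / 3) ∧
    ‖ThreeQubit.wState‖ = 1 ∧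
    ThreeQubit.steeringMaxTotal (ThreeQubit.pureDensity ThreeQubit.wState) +
      3 * ThreeQubit.wEntanglement (ThreeQubit.pureDensity ThreeQubit.wState) = 10 / 3 := by
  refine ⟨fun φ hφ => ?_, ThreeQubit.norm_wState, ?_⟩
  · have h := ThreeQubit.totalTangle_le (ThreeQubit.coeff φ)
    rw [ThreeQubit.totalNormSq_coeff, hφ] at h
    rw [ThreeQubit.steeringMaxTotal_add φ hφ]
    linarith
  · rw [ThreeQubit.steeringMaxTotal_add _ ThreeQubit.norm_wState, ThreeQubit.totalTangle_wState]
    norm_num
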